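/- Let $\varphi:\mathbb{R}^n\to(-\infty,\infty]$ be a proper, lower semicontinuous and prox-bounded function, where, for $\lambda>0$, $e_\lambda\varphi(x):=\inf_{y}\{\varphi(y)+\frac{1}{2\lambda}\|y-x\|^2\}$ is its Moreau envelope, and prox-bounded means that $e_\lambda\varphi(x)>-\infty$ for some $\lambda>0$ and some $x$. Let $\partial\varphi$ be the limiting (Mordukhovich) subdifferential: $v\in\partial\varphi(x)$ iff $\varphi(x)<\infty$ and there are $x_k\to x$ with $\varphi(x_k)\to\varphi(x)$ and $v_k\to v$ such that $\varphi(x_k)<\infty$ and $\liminf_{y\to x_k,\,y\neq x_k}\frac{\varphi(y)-\varphi(x_k)-\langle v_k,y-x_k\rangle}{\|y-x_k\|}\ge 0$ for every $k$. Let $\bar x$ satisfy $\varphi(\bar x)<\infty$, let $\bar v\in\partial\varphi(\bar x)$, and let $\sigma>0$. Then the following are equivalent: (i) $\varphi$ is variationally strongly convex at $\bar x$ for $\bar v$ with modulus $\sigma$: there are convex open neighborhoods $U$ of $\bar x$ and $V$ of $\bar v$, a number $\epsilon>0$, and a proper function $\psi:\mathbb{R}^n\to(-\infty,\infty]$ that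 is lower semicontinuous and strongly convex with modulus $\sigma$ on $U$, with $\psi\le\varphi$ on $U$, such that, for $U_\epsilon:=\{x\in U\mid\varphi(x)<\varphi(\bar x)+\epsilon\}$, $$(U_\epsilon\times V)\cap\operatorname{gph}\partial\varphi=(U\times V)\cap\operatorname{gph}\partial\psi,$$ and $\varphi(x)=\psi(x)$ at all the common elements $(x,v)$. (ii) $\varphi$ is prox-regular at $\bar x$ for $\bar v$, i.e., there are $\epsilon>0$ and $r\ge 0$ with $\varphi(x)\ge\varphi(u)+\langle v,x-u\rangle-\frac r2\|x-u\|^2$ whenever $\|x-\bar x\|\le\epsilon$, $\|u-\bar x\|\le\epsilon$, $\|v-\bar v\|\le\epsilon$, $v\in\partial\varphi(u)$ and $\varphi(u)<\varphi(\bar x)+\epsilon$; and there is $\lambda_0>0$ such that for every $\lambda\in(0,\lambda_0)$ the Moreau envelope $e_\lambda\varphi$ is strongly convex with modulus $\frac{\sigma}{1+\sigma\lambda}$ on some convex neighborhood of $\bar x+\lambda\bar v$. Here $f$ is strongly convex on a convex set $\Omega$ with modulus $\kappa>0$ if $f((1-t)x+ty)\le(1-t)f(x)+tf(y)-\frac{\kappa}{2}t(1-t)\|x-y\|^2$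 for all $x,y\in\Omega$ and $t\in[0,1]$ (with $0\cdot\infty=0$). -/

import Mathlib

open Filter Topology
open scoped InnerProductSpace

namespace VariationalAnalysis

noncomputable section

/-- The effective domain of an extended-real-valued function. -/
def effDomain {E : Type*} (φ : E → EReal) : Set E := {x | φ x < ⊤}

/-- Properness: values in `(-∞, ∞]` and a nonempty effective domain. -/
def IsProper {E : Type*} (φ : E → EReal) : Prop :=
  (∀ x, φ x ≠ ⊥) ∧ (effDomain φ).Nonempty

variable {E : Type*} [NormedAddCommGroup E] [InnerProductSpace ℝ E]

/-- The Fréchet (regular) subdifferential of `φ` at `x`; it is empty off the effective domain. -/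
def regularSubdifferential (φ : E → EReal) (x : E) : Set E :=
  {v | x ∈ effDomain φ ∧
    0 ≤ liminf (fun y : E => (φ y - φ x - ((⟪v, y - x⟫_ℝ : ℝ) : EReal)) / ((‖y - x‖ : ℝ) : EReal))
      (𝓝[≠] x)}

/-- The Mordukhovich (limiting) subdifferential of `φ` at `x`; it is empty off the effective
domain. -/
def limitingSubdifferential (φ : E → EReal) (x : E) : Set E :=
  {v | x ∈ effDomain φ ∧
    ∃ (u : ℕ → E) (w : ℕ → E),
      Tendsto u atTop (𝓝 x) ∧ Tendsto (fun k => φ (u k)) atTop (𝓝 (φ x)) ∧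
      Tendsto w atTop (𝓝 v) ∧ ∀ k, w k ∈ regularSubdifferential φ (u k)}

/-- The graph of the limiting subdifferential mapping. -/
def subdifferentialGraph (φ : E → EReal) : Set (E × E) :=
  {p | p.2 ∈ limitingSubdifferential φ p.1}

/-- Strong convexity with modulus `κ` of an extended-real-valued function on a convex set `s`. -/
def IsStronglyConvexOn (s : Set E) (κ : ℝ) (φ : E → EReal) : Prop :=
  Convex ℝ s ∧ ∀ x ∈ s, ∀ y ∈ s, ∀ t : ℝ, 0 ≤ t → t ≤ 1 →
    φ ((1 - t) • x + t • y) ≤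
      ((1 - t : ℝ) : EReal) * φ x + (t : EReal) * φ y
        - ((κ / 2 * t * (1 - t) * ‖x - y‖ ^ 2 : ℝ) : EReal)

/-- Local strong convexity with modulus `κ` around `x`. -/
def IsLocallyStronglyConvexAt (φ : E → EReal) (x : E) (κ : ℝ) : Prop :=
  ∃ W ∈ 𝓝 x, IsStronglyConvexOn W κ φ

/-- Prox-regularity of `φ` at `xb` for the subgradient `vb`. -/
def IsProxRegularAt (φ : E → EReal) (xb vb : E) : Prop :=
  ∃ ε > (0 : ℝ), ∃ r ≥ (0 : ℝ),
    ∀ x ∈ Metric.closedBall xb ε, ∀ u ∈ Metric.closedBall xb ε, ∀ v ∈ Metric.closedBall vb ε,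
      (u, v) ∈ subdifferentialGraph φ → φ u < φ xb + (ε : EReal) →
        φ u + ((⟪v, x - u⟫_ℝ - r / 2 * ‖x - u‖ ^ 2 : ℝ) : EReal) ≤ φ x

/-- The Moreau envelope `e_lam φ`. -/
def moreauEnvelope (lam : ℝ) (φ : E → EReal) (x : E) : EReal :=
  ⨅ y : E, φ y + ((1 / (2 * lam) * ‖y - x‖ ^ 2 : ℝ) : EReal)

/-- Prox-boundedness. -/
def IsProxBounded (φ : E → EReal) : Prop :=
  ∃ lam > (0 : ℝ), ∃ x : E, ⊥ < moreauEnvelope lam φ x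

/-- Variational strong convexity of `φ` at `xb` for `vb` with modulus `σ`: on a convex open
neighborhood `U × V` of `(xb, vb)` there is a proper l.s.c. function `ψ ≤ φ`, strongly convex with
modulus `σ` on `U`, whose subgradient graph in `U × V` is that of `φ` in `U_ε × V`, where
`U_ε = {x ∈ U | φ x < φ xb + ε}`, with `φ = ψ` at the common elements. -/
def IsVariationallyStronglyConvexAt (φ : E → EReal) (xb vb : E) (σ : ℝ) : Prop :=
  ∃ U V : Set E, IsOpen U ∧ Convex ℝ U ∧ xb ∈ U ∧ IsOpen V ∧ Convex ℝ V ∧ vb ∈ V ∧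
    ∃ ψ : E → EReal, IsProper ψ ∧ LowerSemicontinuousOn ψ U ∧ IsStronglyConvexOn U σ ψ ∧
      (∀ x ∈ U, ψ x ≤ φ x) ∧
      ∃ ε > (0 : ℝ),
        ({x | x ∈ U ∧ φ x < φ xb + (ε : EReal)} ×ˢ V) ∩ subdifferentialGraph φ
            = (U ×ˢ V) ∩ subdifferentialGraph ψ ∧
        ∀ p ∈ (U ×ˢ V) ∩ subdifferentialGraph ψ, φ p.1 = ψ p.1

end

end VariationalAnalysis

namespace VariationalAnalysis

/-! Both conditions amount to one inequality near `(xb, vb)`: for graph pairs `(u, v)` with `φ u < φ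
xb + ε`, φ(x) ≥ φ(u) + ⟪v, x − u⟫ + (σ/2)‖x − u‖². The link to envelopes is that, for small λ, every
z near xb + λvb splits as z = p + λq with p a global proximal point, q ∈ ∂φ(p), and (p, q, φ(p))
near (xb, vb, φ(xb)) (`HasProxMinorant.eventually_exists_proximal`; prox-boundedness makes the local
minorant global).

From (i), the strong subgradient inequality of ψ passes to φ ≥ ψ, giving prox-regularity with r = 0.
Near xb + λvb the envelope is ψ(p) + (λ/2)‖q‖², and the curvatures σ and 1/λ combine in parallel to
σ/(1 + σλ).

From (ii), a single small λ suffices. Prox-regularity makes each localized graph point u a proximal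
point of u + λv, so the envelope has there an exact quadratic upper model with slope v. With strong
convexity this yields a strong subgradient inequality for the envelope, and
`le_of_le_moreauEnvelope` turns it into the inequality above. Let ψ be the supremum of these
quadratics. It is strongly convex, lies below φ near xb and touches φ on the localized graph. It has
no further subgradients: a pair (x, v) in gph ∂ψ and the proximal pair (p, q) with p + λq = x + λv
must coincide by strong monotonicity, as in Minty's argument. -/

lemma exists_real_of_mem_effDomain {α : Type*} {φ : α → EReal} (hbot : ∀ x, φ x ≠ ⊥)
    {x : α} (hx : x ∈ effDomain φ) : ∃ a : ℝ, φ x = a :=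
  ⟨(φ x).toReal, (EReal.coe_toReal (ne_of_lt hx) (hbot x)).symm⟩

lemma moreauEnvelope_le {E : Type*} [NormedAddCommGroup E] (lam : ℝ) {φ : E → EReal} {u : E}
    {a : ℝ} (hu : φ u = a) (z : E) :
    moreauEnvelope lam φ z ≤ ((a + 1 / (2 * lam) * ‖u - z‖ ^ 2 : ℝ) : EReal) := by
  refine (iInf_le _ u).trans ?_
  rw [hu]
  norm_cast

variable {E : Type*} [NormedAddCommGroup E] [InnerProductSpace ℝ E]

/-! ### Quadratic minorants and subgradients -/

/-- `φ` takes the real value `a` at `u` and is globally minorized by the concave quadratic with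
slope `v` and curvature `-c` passing through `(u, a)`. -/
structure HasProxMinorant (φ : E → EReal) (c : ℝ) (u v : E) (a : ℝ) : Prop where
  eq : φ u = a
  le : ∀ y, ((a + ⟪v, y - u⟫_ℝ - c / 2 * ‖y - u‖ ^ 2 : ℝ) : EReal) ≤ φ y

lemma regularSubdifferential_subset_limiting (φ : E → EReal) (x : E) :
    regularSubdifferential φ x ⊆ limitingSubdifferential φ x := fun v hv =>
  ⟨hv.1, fun _ => x, fun _ => v, tendsto_const_nhds, tendsto_const_nhds, tendsto_const_nhds,
    fun _ => hv⟩

/-- A local quadratic minorant gives a regular subgradient. -/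
lemma mem_regularSubdifferential_of_eventually {φ : E → EReal} {c : ℝ} {u v : E} {a : ℝ}
    (hu : φ u = a)
    (h : ∀ᶠ y in 𝓝 u, ((a + ⟪v, y - u⟫_ℝ - c / 2 * ‖y - u‖ ^ 2 : ℝ) : EReal) ≤ φ y) :
    v ∈ regularSubdifferential φ u := by
  refine ⟨by simp [effDomain, hu], ?_⟩
  rw [le_liminf_iff]
  intro s hs
  obtain ⟨s', hss', hs'⟩ := EReal.lt_iff_exists_real_btwn.1 hs
  have hs0 : s' < 0 := by exact_mod_cast hs'
  have hlim : Tendsto (fun y : E => -(c / 2 * ‖y - u‖)) (𝓝 u) (𝓝 0) := by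
    have : Continuous fun y : E => -(c / 2 * ‖y - u‖) := by fun_prop
    simpa using this.tendsto u
  filter_upwards [nhdsWithin_le_nhds h, nhdsWithin_le_nhds (hlim.eventually (lt_mem_nhds hs0)),
    self_mem_nhdsWithin] with y hy1 hy2 hy3
  have hn : 0 < ‖y - u‖ := norm_pos_iff.2 (sub_ne_zero.2 hy3)
  refine hss'.trans_le ?_
  rw [EReal.le_div_iff_mul_le (by exact_mod_cast hn) (EReal.coe_ne_top _), hu]
  induction hφ : φ y with
  | bot =>
    rw [hφ, le_bot_iff] at hy1
    exact absurd hy1 (EReal.coe_ne_bot _)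
  | top => simp
  | coe b =>
    rw [hφ] at hy1
    norm_cast at hy1 ⊢
    nlinarith

lemma HasProxMinorant.mem_limitingSubdifferential {φ : E → EReal} {c : ℝ} {u v : E} {a : ℝ}
    (h : HasProxMinorant φ c u v a) : v ∈ limitingSubdifferential φ u :=
  regularSubdifferential_subset_limiting φ u
    (mem_regularSubdifferential_of_eventually h.eq (Eventually.of_forall h.le))

/-- Regular subgradients of a strongly convex function satisfy the strong subgradient
inequality. -/
lemma IsStronglyConvexOn.le_of_mem_regularSubdifferential {ψ : E → EReal} {U : Set E} {σ : ℝ}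
    (hψ : IsStronglyConvexOn U σ ψ) (hbot : ∀ x, ψ x ≠ ⊥) {u v x : E} (hu : u ∈ U)
    (hx : x ∈ U) (hv : v ∈ regularSubdifferential ψ u) {b : ℝ} (hb : ψ x = b) :
    ψ u ≤ ((b - ⟪v, x - u⟫_ℝ - σ / 2 * ‖x - u‖ ^ 2 : ℝ) : EReal) := by
  obtain ⟨a, ha⟩ := exists_real_of_mem_effDomain hbot hv.1
  rw [ha]
  norm_cast
  rcases eq_or_ne x u with rfl | hne
  · rw [ha] at hb
    have : a = b := by exact_mod_cast hb
    simp [this]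
  have hd : 0 < ‖x - u‖ := norm_pos_iff.2 (sub_ne_zero.2 hne)
  set d := x - u with hd_def
  -- The liminf is tested along the segment from `u` to `x`; dividing by `t`, then `t → 0` and `η →
  -- 0`, gives the claim.
  have key : ∀ η > (0 : ℝ), ∀ᶠ t : ℝ in 𝓝[>] 0,
      a + ⟪v, d⟫_ℝ - η * ‖d‖ ≤ b - σ / 2 * (1 - t) * ‖d‖ ^ 2 := by
    intro η hη
    have h0 := hv.2
    rw [le_liminf_iff] at h0
    have h1 := h0 ((-η : ℝ) : EReal) (by exact_mod_cast neg_lt_zero.2 hη)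
    have hcurve : Tendsto (fun t : ℝ => u + t • d) (𝓝[>] 0) (𝓝[≠] u) := by
      refine tendsto_nhdsWithin_iff.2 ⟨?_, ?_⟩
      · have : Continuous fun t : ℝ => u + t • d := by fun_prop
        simpa using (this.tendsto 0).mono_left nhdsWithin_le_nhds
      · filter_upwards [self_mem_nhdsWithin] with t ht
        have ht : (0 : ℝ) < t := ht
        simp [ht.ne', norm_pos_iff.1 hd]
    have hlt1 : ∀ᶠ t : ℝ in 𝓝[>] 0, t < 1 := nhdsWithin_le_nhds (gt_mem_nhds one_pos)
    filter_upwards [hcurve.eventually h1, hlt1, self_mem_nhdsWithin] with t ht ht1 ht0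
    have ht0 : (0 : ℝ) < t := ht0
    have h2 := hψ.2 u hu x hx t ht0.le ht1.le
    have hpt : (1 - t) • u + t • x = u + t • d := by rw [hd_def]; module
    have hn : ‖u - x‖ = ‖d‖ := norm_sub_rev _ _
    rw [hpt, hn, ha, hb] at h2
    have hnt : ‖u + t • d - u‖ = t * ‖d‖ := by simp [norm_smul, abs_of_pos ht0]
    have hit : ⟪v, u + t • d - u⟫_ℝ = t * ⟪v, d⟫_ℝ := by simp [inner_smul_right]
    have h3 := ht.le
    rw [EReal.le_div_iff_mul_le (by rw [hnt]; exact_mod_cast mul_pos ht0 hd)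
      (EReal.coe_ne_top _), hnt, hit, ha] at h3
    induction hφ : ψ (u + t • d) with
    | bot => exact absurd hφ (hbot _)
    | top =>
      rw [hφ] at h2
      norm_cast at h2
    | coe e =>
      rw [hφ] at h2 h3
      norm_cast at h2 h3
      have h4 : t * (a + ⟪v, d⟫_ℝ - η * ‖d‖) ≤ t * (b - σ / 2 * (1 - t) * ‖d‖ ^ 2) := by
        nlinarith
      exact le_of_mul_le_mul_left h4 ht0
  have key2 : ∀ η > (0 : ℝ), a + ⟪v, d⟫_ℝ - η * ‖d‖ ≤ b - σ / 2 * ‖d‖ ^ 2 := by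
    intro η hη
    have hc : Continuous fun t : ℝ => b - σ / 2 * (1 - t) * ‖d‖ ^ 2 := by fun_prop
    have hlim : Tendsto (fun t : ℝ => b - σ / 2 * (1 - t) * ‖d‖ ^ 2) (𝓝[>] 0)
        (𝓝 (b - σ / 2 * ‖d‖ ^ 2)) := by
      simpa using (hc.tendsto 0).mono_left (nhdsWithin_le_nhds (s := Set.Ioi 0))
    exact ge_of_tendsto hlim (key η hη)
  refine le_of_forall_pos_le_add fun η hη => ?_
  have := key2 (η / ‖d‖) (div_pos hη hd)
  rw [div_mul_cancel₀ _ hd.ne'] at this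
  linarith

/-- Limiting subgradients of a strongly convex function satisfy the strong subgradient
inequality. -/
lemma IsStronglyConvexOn.add_le_of_mem_limitingSubdifferential {ψ : E → EReal} {U : Set E} {σ : ℝ}
    (hψ : IsStronglyConvexOn U σ ψ) (hU : IsOpen U) (hbot : ∀ x, ψ x ≠ ⊥) {u v : E}
    (hu : u ∈ U) (hv : v ∈ limitingSubdifferential ψ u) {a : ℝ} (ha : ψ u = a) {x : E}
    (hx : x ∈ U) : ((a + ⟪v, x - u⟫_ℝ + σ / 2 * ‖x - u‖ ^ 2 : ℝ) : EReal) ≤ ψ x := by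
  obtain ⟨-, us, ws, hus, hψs, hws, hreg⟩ := hv
  induction hb : ψ x with
  | bot => exact absurd hb (hbot _)
  | top => simp
  | coe b =>
    have hev : ∀ᶠ k in atTop, ψ (us k) ≤
        ((b - ⟪ws k, x - us k⟫_ℝ - σ / 2 * ‖x - us k‖ ^ 2 : ℝ) : EReal) := by
      filter_upwards [hus.eventually (hU.mem_nhds hu)] with k hk
      exact hψ.le_of_mem_regularSubdifferential hbot hk hx (hreg k) hb
    have hxs : Tendsto (fun k => x - us k) atTop (𝓝 (x - u)) := tendsto_const_nhds.sub hus
    have hlim : Tendsto (fun k => b - ⟪ws k, x - us k⟫_ℝ - σ / 2 * ‖x - us k‖ ^ 2) atTop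
        (𝓝 (b - ⟪v, x - u⟫_ℝ - σ / 2 * ‖x - u‖ ^ 2)) :=
      (tendsto_const_nhds.sub (hws.inner hxs)).sub ((hxs.norm.pow 2).const_mul _)
    have h := le_of_tendsto_of_tendsto hψs ((continuous_coe_real_ereal.tendsto _).comp hlim) hev
    rw [ha] at h
    norm_cast at h ⊢
    linarith

/-! ### Proximal points -/

/-- A local quadratic minorant of a prox-bounded function extends to a global one. -/
lemma IsProxBounded.exists_hasProxMinorant {φ : E → EReal} (hbot : ∀ x, φ x ≠ ⊥)
    (hpb : IsProxBounded φ) {u v : E} {a r δ : ℝ} (hu : φ u = a) (hr : 0 ≤ r) (hδ : 0 < δ)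
    (h : ∀ y ∈ Metric.closedBall u δ,
      ((a + ⟪v, y - u⟫_ℝ - r / 2 * ‖y - u‖ ^ 2 : ℝ) : EReal) ≤ φ y) :
    ∃ R, r ≤ R ∧ HasProxMinorant φ R u v a := by
  obtain ⟨l, hl, x₀, hx₀⟩ := hpb
  obtain ⟨c, -, hc⟩ := EReal.lt_iff_exists_real_btwn.1 hx₀
  set D := ‖u - x₀‖
  have hD : 0 ≤ D := norm_nonneg _
  -- The three terms dominate the constant, linear and off-centre quadratic errors by multiples of
  -- `‖y - u‖ ^ 2`, which works outside the ball because `‖y - u‖ / δ ≥ 1` there.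
  set M := |a - c| / δ ^ 2 + ‖v‖ / δ + 1 / (2 * l) * (1 + D / δ) ^ 2 with hM
  have hM0 : 0 ≤ M := by positivity
  refine ⟨r + 2 * M, by linarith, hu, fun y => ?_⟩
  by_cases hy : y ∈ Metric.closedBall u δ
  · refine le_trans ?_ (h y hy)
    norm_cast
    nlinarith [sq_nonneg ‖y - u‖]
  · have hyδ : δ < ‖y - u‖ := by simpa [dist_eq_norm] using hy
    have hcy : (c : EReal) ≤ φ y + ((1 / (2 * l) * ‖y - x₀‖ ^ 2 : ℝ) : EReal) :=
      hc.le.trans (iInf_le _ y)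
    induction hφ : φ y with
    | bot => exact absurd hφ (hbot _)
    | top => simp
    | coe b =>
      rw [hφ] at hcy
      norm_cast at hcy ⊢
      set d := ‖y - u‖
      have hin : ⟪v, y - u⟫_ℝ ≤ ‖v‖ * d := real_inner_le_norm _ _
      have htri : ‖y - x₀‖ ≤ d + D := by
        simpa using norm_add_le (y - u) (u - x₀)
      have hd1 : 1 ≤ d / δ := (one_le_div hδ).2 hyδ.le
      have hd0 : 0 < d := hδ.trans hyδ
      have e1 : a - c ≤ |a - c| / δ ^ 2 * d ^ 2 := by
        have : |a - c| / δ ^ 2 * d ^ 2 = |a - c| * (d / δ) ^ 2 := by field_simp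
        rw [this]
        exact (le_abs_self _).trans (le_mul_of_one_le_right (abs_nonneg _) (one_le_pow₀ hd1))
      have e2 : ‖v‖ * d ≤ ‖v‖ / δ * d ^ 2 := by
        have : ‖v‖ / δ * d ^ 2 = ‖v‖ * d * (d / δ) := by field_simp
        rw [this]
        exact le_mul_of_one_le_right (by positivity) hd1
      have e3 : 1 / (2 * l) * ‖y - x₀‖ ^ 2 ≤ 1 / (2 * l) * (1 + D / δ) ^ 2 * d ^ 2 := by
        rw [mul_assoc, ← mul_pow]
        have : d + D ≤ (1 + D / δ) * d := by
          have : (1 + D / δ) * d = d + D * (d / δ) := by field_simp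
          rw [this]
          nlinarith
        gcongr
        exact htri.trans this
      have e4 : 0 ≤ r / 2 * d ^ 2 := by positivity
      have : (r + 2 * M) / 2 * d ^ 2 = r / 2 * d ^ 2 + (|a - c| / δ ^ 2 * d ^ 2
          + ‖v‖ / δ * d ^ 2 + 1 / (2 * l) * (1 + D / δ) ^ 2 * d ^ 2) := by rw [hM]; ring
      linarith

/-- At `u + lam • v` the Moreau envelope is attained at `u`. -/
lemma HasProxMinorant.moreauEnvelope_eq {φ : E → EReal} {lam : ℝ} (hlam : 0 < lam) {u v : E}
    {a : ℝ} (h : HasProxMinorant φ lam⁻¹ u v a) :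
    moreauEnvelope lam φ (u + lam • v) = ((a + lam / 2 * ‖v‖ ^ 2 : ℝ) : EReal) := by
  have hid : ∀ y : E, 1 / (2 * lam) * ‖y - (u + lam • v)‖ ^ 2 =
      lam⁻¹ / 2 * ‖y - u‖ ^ 2 - ⟪v, y - u⟫_ℝ + lam / 2 * ‖v‖ ^ 2 := by
    intro y
    rw [← sub_sub, norm_sub_sq_real, inner_smul_right, norm_smul, Real.norm_of_nonneg hlam.le,
      real_inner_comm]
    field_simp
  apply le_antisymm
  · refine (iInf_le _ u).trans ?_
    rw [h.eq, hid]
    norm_cast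
    simp
  · refine le_iInf fun y => ?_
    have hy := h.le y
    rw [hid]
    induction hφ : φ y with
    | bot =>
      rw [hφ, le_bot_iff] at hy
      exact absurd hy (EReal.coe_ne_bot _)
    | top =>
      rw [EReal.top_add_coe]
      exact le_top
    | coe b =>
      rw [hφ] at hy
      norm_cast at hy ⊢
      linarith

/-- Existence of proximal points, with a linear bound on their displacement. -/
lemma HasProxMinorant.exists_proximal [ProperSpace E] {φ : E → EReal} (hbot : ∀ x, φ x ≠ ⊥)
    (hlsc : LowerSemicontinuous φ) {R : ℝ} {u v : E} {a : ℝ} (h : HasProxMinorant φ R u v a)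
    {lam : ℝ} (hlam : 0 < lam) (hR : lam * R ≤ 1 / 2) (w : E) :
    ∃ p q b, p + lam • q = u + lam • v + w ∧ ‖p - u‖ ≤ 4 * ‖w‖ ∧
      HasProxMinorant φ lam⁻¹ p q b := by
  -- The proximal quadratic centred at `u + lam • v + w`, normalized to vanish at `u`.
  set k : E → ℝ := fun y => lam⁻¹ / 2 * ‖y - u‖ ^ 2 - ⟪v + lam⁻¹ • w, y - u⟫_ℝ with hk
  have hkc : Continuous k := by fun_prop
  have hku : k u = 0 := by simp [hk]
  have hf : LowerSemicontinuous fun y => φ y + (k y : EReal) := by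
    refine hlsc.add' (continuous_coe_real_ereal.comp hkc).lowerSemicontinuous fun x => ?_
    exact EReal.continuousAt_add (Or.inr (EReal.coe_ne_bot _)) (Or.inr (EReal.coe_ne_top _))
  have hball : u ∈ Metric.closedBall u (4 * ‖w‖) := by simp
  obtain ⟨p, hp, hmin⟩ := (hf.lowerSemicontinuousOn _).exists_isMinOn ⟨u, hball⟩
    (isCompact_closedBall u (4 * ‖w‖))
  -- Since `lam * R ≤ 1 / 2`, the objective times `lam` grows from its value at `u` by at least `‖y
  -- - u‖ ^ 2 / 4 - ‖w‖ * ‖y - u‖`, nonnegative beyond radius `4 * ‖w‖`.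
  have hglob : ∀ y, φ p + (k p : EReal) ≤ φ y + (k y : EReal) := by
    intro y
    by_cases hy : y ∈ Metric.closedBall u (4 * ‖w‖)
    · exact hmin hy
    refine (show φ p + (k p : EReal) ≤ φ u + (k u : EReal) from hmin hball).trans ?_
    have hy' : 4 * ‖w‖ < ‖y - u‖ := by simpa [dist_eq_norm] using hy
    have hle := h.le y
    rw [h.eq, hku]
    induction hφ : φ y with
    | bot => exact absurd hφ (hbot _)
    | top =>
      rw [EReal.top_add_coe]
      exact le_top
    | coe b =>
      rw [hφ] at hle
      norm_cast at hle ⊢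
      rw [hk]
      simp only [inner_add_left, inner_smul_left]
      have hin : ⟪w, y - u⟫_ℝ ≤ ‖w‖ * ‖y - u‖ := real_inner_le_norm _ _
      simp only [conj_trivial]
      have h1 : lam * (a + 0) ≤
          lam * (b + (lam⁻¹ / 2 * ‖y - u‖ ^ 2 - (⟪v, y - u⟫_ℝ + lam⁻¹ * ⟪w, y - u⟫_ℝ))) := by
        have : lam * (b + (lam⁻¹ / 2 * ‖y - u‖ ^ 2 - (⟪v, y - u⟫_ℝ + lam⁻¹ * ⟪w, y - u⟫_ℝ))) =
            lam * (b - ⟪v, y - u⟫_ℝ) + ‖y - u‖ ^ 2 / 2 - ⟪w, y - u⟫_ℝ := by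
          field_simp
          ring
        rw [this]
        nlinarith [norm_nonneg w, mul_le_mul_of_nonneg_left hle hlam.le,
          mul_le_mul_of_nonneg_right hR (sq_nonneg ‖y - u‖)]
      exact le_of_mul_le_mul_left h1 hlam
  have hpfin : p ∈ effDomain φ := by
    have := hglob u
    rw [h.eq, hku] at this
    by_contra htop
    have htop : φ p = ⊤ := by simpa [effDomain] using htop
    rw [htop, EReal.top_add_coe] at this
    norm_cast at this
  obtain ⟨b, hb⟩ := exists_real_of_mem_effDomain hbot hpfin
  refine ⟨p, v + lam⁻¹ • (w - (p - u)), b, ?_, by simpa [dist_eq_norm] using hp, hb, fun y => ?_⟩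
  · rw [smul_add, smul_smul, mul_inv_cancel₀ hlam.ne']
    module
  · have hy := hglob y
    rw [hb] at hy
    induction hφ : φ y with
    | bot => exact absurd hφ (hbot _)
    | top => simp
    | coe e =>
      rw [hφ] at hy
      norm_cast at hy ⊢
      refine le_trans (le_of_eq ?_) (sub_le_iff_le_add.2 hy)
      have hyu : y - u = (y - p) + (p - u) := by abel
      rw [hk]
      simp only
      rw [hyu, norm_add_sq_real]
      simp only [inner_add_left, inner_smul_left, inner_sub_left, inner_add_right, conj_trivial,
        real_inner_comm (p - u) (y - p)]
      ring

/-- Proximal points near `u + lam • v` are close to `u` in graph and value. -/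
lemma HasProxMinorant.eventually_exists_proximal [ProperSpace E] {φ : E → EReal}
    (hbot : ∀ x, φ x ≠ ⊥) (hlsc : LowerSemicontinuous φ) {R : ℝ} {u v : E} {a : ℝ}
    (h : HasProxMinorant φ R u v a) {lam : ℝ} (hlam : 0 < lam) (hR : lam * R ≤ 1 / 2) {δ : ℝ}
    (hδ : 0 < δ) :
    ∃ η > 0, ∀ z ∈ Metric.ball (u + lam • v) η, ∃ p ∈ Metric.ball u δ, ∃ q ∈ Metric.ball v δ,
      ∃ b < a + δ, p + lam • q = z ∧ HasProxMinorant φ lam⁻¹ p q b := by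
  -- The 5 is 1 + 4: `lam • (q - v)` is the shift of `z` minus `p - u`. `F` bounds `b - a`, by
  -- testing the minorant of `p` at `u`.
  set C : ℝ := 5 / lam
  have hC : 0 < C := by positivity
  set F : ℝ → ℝ := fun s => (‖v‖ + C * s) * (4 * s) + lam⁻¹ / 2 * (4 * s) ^ 2 with hF
  have hFc : Continuous F := by fun_prop
  have hF0 : Tendsto F (𝓝 0) (𝓝 0) := by simpa [hF] using hFc.tendsto 0
  obtain ⟨η₁, hη₁, hFη⟩ := Metric.eventually_nhds_iff.1 (hF0.eventually (gt_mem_nhds hδ))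
  refine ⟨min η₁ (min (δ / 4) (δ / C)), by positivity, fun z hz => ?_⟩
  obtain ⟨p, q, b, hz', hp, hmin⟩ :=
    h.exists_proximal hbot hlsc hlam hR (z - (u + lam • v))
  rw [add_sub_cancel] at hz'
  set s := ‖z - (u + lam • v)‖ with hs
  have hsz : s < min η₁ (min (δ / 4) (δ / C)) := by simpa [dist_eq_norm] using hz
  have hs0 : 0 ≤ s := norm_nonneg _
  obtain ⟨hs1, hs2, hs3⟩ := by simpa only [lt_min_iff] using hsz
  have hq : ‖q - v‖ ≤ C * s := by
    have h1 : lam • (q - v) = (z - (u + lam • v)) - (p - u) := by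
      rw [← hz']; module
    have h2 : lam * ‖q - v‖ ≤ s + 4 * s := by
      rw [← abs_of_pos hlam, ← Real.norm_eq_abs, ← norm_smul, h1]
      exact (norm_sub_le _ _).trans (by linarith)
    have h3 : C * s = (s + 4 * s) / lam := by simp only [C]; ring
    rw [h3, le_div_iff₀ hlam]
    linarith
  refine ⟨p, ?_, q, ?_, b, ?_, hz', hmin⟩
  · rw [mem_ball_iff_norm]; linarith
  · rw [mem_ball_iff_norm]
    rw [lt_div_iff₀ hC] at hs3
    linarith
  · have hle := hmin.le u
    rw [h.eq] at hle
    norm_cast at hle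
    have hFs : F s < δ := hFη (by simpa [abs_of_nonneg hs0] using hs1)
    have hin : -⟪q, u - p⟫_ℝ ≤ (‖v‖ + C * s) * (4 * s) := by
      rw [← inner_neg_right, neg_sub]
      refine (real_inner_le_norm _ _).trans ?_
      have : ‖q‖ ≤ ‖v‖ + C * s := by
        have := norm_add_le v (q - v)
        rw [add_sub_cancel] at this
        linarith
      gcongr
    have hsq : lam⁻¹ / 2 * ‖u - p‖ ^ 2 ≤ lam⁻¹ / 2 * (4 * s) ^ 2 := by
      rw [norm_sub_rev]
      gcongr
    simp only [hF] at hFs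
    linarith

/-! ### From variational strong convexity to the envelopes -/

lemma norm_convexCombo_sq (t : ℝ) (x y : E) :
    ‖(1 - t) • x + t • y‖ ^ 2 =
      (1 - t) * ‖x‖ ^ 2 + t * ‖y‖ ^ 2 - t * (1 - t) * ‖x - y‖ ^ 2 := by
  rw [norm_add_sq_real, norm_sub_sq_real, inner_smul_left, inner_smul_right, norm_smul, norm_smul,
    mul_pow, mul_pow, Real.norm_eq_abs, Real.norm_eq_abs, sq_abs, sq_abs, conj_trivial]
  ring

/-- The parallel-sum bound for the quadratics with moduli `σ` and `lam⁻¹`. -/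
lemma norm_add_smul_sq_le {σ lam : ℝ} (hσ : 0 < σ) (hlam : 0 < lam) (x y : E) :
    σ / (1 + σ * lam) * ‖x + lam • y‖ ^ 2 ≤ σ * ‖x‖ ^ 2 + lam * ‖y‖ ^ 2 := by
  have h1 : 0 < 1 + σ * lam := by positivity
  have h2 : 0 ≤ ‖σ • x - y‖ ^ 2 := sq_nonneg _
  rw [norm_sub_sq_real, inner_smul_left, norm_smul, mul_pow, Real.norm_eq_abs, sq_abs,
    conj_trivial] at h2
  rw [div_mul_eq_mul_div, div_le_iff₀ h1, norm_add_sq_real, inner_smul_right, norm_smul, mul_pow,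
    Real.norm_eq_abs, sq_abs]
  nlinarith

/-- The subdifferential inequality for the minorizing function of a variationally strongly convex
function yields prox-regularity. -/
lemma IsVariationallyStronglyConvexAt.isProxRegularAt {φ : E → EReal} (hbot : ∀ x, φ x ≠ ⊥)
    {xb vb : E} {σ : ℝ} (hσ : 0 < σ) (h : IsVariationallyStronglyConvexAt φ xb vb σ) :
    IsProxRegularAt φ xb vb := by
  obtain ⟨U, V, hU, -, hxU, hV, -, hvV, ψ, hψp, -, hψ, hle, ε, hε, hgph, heq⟩ := h
  obtain ⟨δ₁, hδ₁, hδU⟩ := Metric.nhds_basis_closedBall.mem_iff.1 (hU.mem_nhds hxU)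
  obtain ⟨δ₂, hδ₂, hδV⟩ := Metric.nhds_basis_closedBall.mem_iff.1 (hV.mem_nhds hvV)
  have hU' : Metric.closedBall xb (min ε (min δ₁ δ₂)) ⊆ U :=
    (Metric.closedBall_subset_closedBall ((min_le_right _ _).trans (min_le_left _ _))).trans hδU
  have hV' : Metric.closedBall vb (min ε (min δ₁ δ₂)) ⊆ V :=
    (Metric.closedBall_subset_closedBall ((min_le_right _ _).trans (min_le_right _ _))).trans hδV
  refine ⟨min ε (min δ₁ δ₂), by positivity, 0, le_rfl, fun x hx u hu v hv huv hφu => ?_⟩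
  have hmem : (u, v) ∈ ({x | x ∈ U ∧ φ x < φ xb + (ε : EReal)} ×ˢ V) ∩ subdifferentialGraph φ :=
    ⟨⟨⟨hU' hu, hφu.trans_le (by gcongr; exact_mod_cast min_le_left _ _)⟩, hV' hv⟩, huv⟩
  have huψ := heq _ (hgph ▸ hmem)
  obtain ⟨a, ha⟩ := exists_real_of_mem_effDomain hbot huv.1
  have ha' : ψ u = a := huψ.symm.trans ha
  refine le_trans ?_ ((hψ.add_le_of_mem_limitingSubdifferential hU hψp.1 (hU' hu)
    (hgph ▸ hmem).2 ha' (hU' hx)).trans (hle x (hU' hx)))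
  rw [ha]
  norm_cast
  have : 0 ≤ σ / 2 * ‖x - u‖ ^ 2 := by positivity
  simp only [zero_div, zero_mul]
  linarith

/-- Moreau envelopes of a variationally strongly convex function are locally strongly convex. -/
lemma IsVariationallyStronglyConvexAt.isLocallyStronglyConvexAt_moreauEnvelope [ProperSpace E] {φ : E → EReal}
    (hbot : ∀ x, φ x ≠ ⊥) (hlsc : LowerSemicontinuous φ) (hpb : IsProxBounded φ) {xb vb : E}
    (hvb : vb ∈ limitingSubdifferential φ xb) {σ : ℝ} (hσ : 0 < σ)
    (h : IsVariationallyStronglyConvexAt φ xb vb σ) :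
    ∃ lam₀ > (0 : ℝ), ∀ lam : ℝ, 0 < lam → lam < lam₀ →
      IsLocallyStronglyConvexAt (moreauEnvelope lam φ) (xb + lam • vb) (σ / (1 + σ * lam)) := by
  obtain ⟨U, V, hU, hUc, hxU, hV, -, hvV, ψ, hψp, -, hψ, hle, ε, hε, hgph, heq⟩ := h
  obtain ⟨a, ha⟩ := exists_real_of_mem_effDomain hbot hvb.1
  have haε : φ xb < φ xb + (ε : EReal) := by
    rw [ha]; exact_mod_cast lt_add_of_pos_right a hε
  have transfer : ∀ u ∈ U, ∀ v ∈ V, ∀ b : ℝ, φ u = b → b < a + ε →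
      v ∈ limitingSubdifferential φ u → ψ u = b ∧ ∀ x ∈ U,
        ((b + ⟪v, x - u⟫_ℝ + σ / 2 * ‖x - u‖ ^ 2 : ℝ) : EReal) ≤ ψ x := by
    intro u hu v hv b hb hba huv
    have hmem : (u, v) ∈ ({x | x ∈ U ∧ φ x < φ xb + (ε : EReal)} ×ˢ V) ∩
        subdifferentialGraph φ :=
      ⟨⟨⟨hu, by rw [hb, ha]; exact_mod_cast hba⟩, hv⟩, huv⟩
    have hψu : ψ u = b := (heq _ (hgph ▸ hmem)).symm.trans hb
    exact ⟨hψu, fun x hx => hψ.add_le_of_mem_limitingSubdifferential hU hψp.1 hu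
      (hgph ▸ hmem).2 hψu hx⟩
  obtain ⟨δ₁, hδ₁, hδU⟩ := Metric.nhds_basis_closedBall.mem_iff.1 (hU.mem_nhds hxU)
  obtain ⟨δ₂, hδ₂, hδV⟩ := Metric.nhds_basis_closedBall.mem_iff.1 (hV.mem_nhds hvV)
  obtain ⟨R, hR0, hR⟩ := hpb.exists_hasProxMinorant (v := vb) hbot ha le_rfl hδ₁ (fun y hy => by
    refine le_trans ?_
      (((transfer xb hxU vb hvV a ha (by linarith) hvb).2 y (hδU hy)).trans (hle y (hδU hy)))
    norm_cast
    have : 0 ≤ σ / 2 * ‖y - xb‖ ^ 2 := by positivity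
    simp only [zero_div, zero_mul]
    linarith)
  refine ⟨1 / (2 * R + 1), by positivity, fun lam hlam hlam' => ?_⟩
  have hlamR : lam * R ≤ 1 / 2 := by
    rw [lt_div_iff₀ (by positivity)] at hlam'
    linarith
  obtain ⟨η, hη, hprox⟩ := hR.eventually_exists_proximal hbot hlsc hlam hlamR
    (δ := min ε (min δ₁ δ₂)) (by positivity)
  have hprox' : ∀ z ∈ Metric.ball (xb + lam • vb) η, ∃ p ∈ U, ∃ q, ∃ b : ℝ,
      p + lam • q = z ∧ moreauEnvelope lam φ z = ((b + lam / 2 * ‖q‖ ^ 2 : ℝ) : EReal) ∧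
      ψ p = b ∧ ∀ x ∈ U, ((b + ⟪q, x - p⟫_ℝ : ℝ) : EReal) ≤ ψ x := by
    intro z hz
    obtain ⟨p, hp, q, hq, b, hb, hpq, hmin⟩ := hprox z hz
    have hpU : p ∈ U := hδU (Metric.ball_subset_closedBall (Metric.ball_subset_ball
      ((min_le_right _ _).trans (min_le_left _ _)) hp))
    have hqV : q ∈ V := hδV (Metric.ball_subset_closedBall (Metric.ball_subset_ball
      ((min_le_right _ _).trans (min_le_right _ _)) hq))
    obtain ⟨h1, h2⟩ := transfer p hpU q hqV b hmin.eq
      (hb.trans_le (by gcongr; exact min_le_left _ _)) hmin.mem_limitingSubdifferential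
    refine ⟨p, hpU, q, b, hpq, hpq ▸ hmin.moreauEnvelope_eq hlam, h1, fun x hx => ?_⟩
    refine le_trans ?_ (h2 x hx)
    norm_cast
    have : 0 ≤ σ / 2 * ‖x - p‖ ^ 2 := by positivity
    linarith
  refine ⟨_, Metric.ball_mem_nhds _ hη, convex_ball _ _, fun x hx y hy t ht0 ht1 => ?_⟩
  have hz := convex_ball (xb + lam • vb) η hx hy (sub_nonneg.2 ht1) ht0 (by ring)
  obtain ⟨p₀, hp₀, q₀, b₀, hx', he₀, hψ₀, -⟩ := hprox' x hx
  obtain ⟨p₁, hp₁, q₁, b₁, hy', he₁, hψ₁, -⟩ := hprox' y hy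
  obtain ⟨p, hp, q, b, hz', he, -, hsub⟩ := hprox' _ hz
  rw [he₀, he₁, he]
  -- Strong convexity of `ψ` between `p₀` and `p₁` is compared with its supporting inequality at
  -- `p`, evaluated at their convex combination.
  have hc := hψ.2 p₀ hp₀ p₁ hp₁ t ht0 ht1
  have hs := (hsub _ (hUc hp₀ hp₁ (sub_nonneg.2 ht1) ht0 (by ring))).trans hc
  rw [hψ₀, hψ₁] at hs
  norm_cast at hs ⊢
  set r := (1 - t) • q₀ + t • q₁ with hr
  have hpr : (1 - t) • p₀ + t • p₁ - p = lam • (q - r) := by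
    rw [← hx', ← hy'] at hz'
    rw [sub_eq_iff_eq_add, smul_sub, sub_add_eq_add_sub, eq_sub_iff_add_eq, add_comm (lam • q),
      hz', hr]
    module
  have hdiff : x - y = (p₀ - p₁) + lam • (q₀ - q₁) := by rw [← hx', ← hy']; module
  rw [hpr, inner_smul_right, inner_sub_right, real_inner_self_eq_norm_sq] at hs
  have h1 := norm_convexCombo_sq t q₀ q₁
  have h2 := norm_add_smul_sq_le hσ hlam (p₀ - p₁) (q₀ - q₁)
  rw [← hdiff] at h2
  have h3 : 0 ≤ ‖q - r‖ ^ 2 := sq_nonneg _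
  rw [norm_sub_sq_real] at h3
  rw [← hr] at h1
  have h4 := mul_le_mul_of_nonneg_left h2 (mul_nonneg ht0 (sub_nonneg.2 ht1))
  have h5 := mul_nonneg hlam.le h3
  have h6 : lam * ‖r‖ ^ 2 = lam * ((1 - t) * ‖q₀‖ ^ 2 + t * ‖q₁‖ ^ 2
    - t * (1 - t) * ‖q₀ - q₁‖ ^ 2) := by rw [h1]
  linarith

/-! ### From the envelopes back to the function -/

/-- A quadratic upper model of a strongly convex function that is exact at `z` supplies a strong
subgradient there. -/
lemma strong_subgradient_of_quadratic_upper_bound {g : E → ℝ} {s : Set E} (hs : IsOpen s) {κ K : ℝ}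
    (hg : ∀ x ∈ s, ∀ y ∈ s, ∀ t : ℝ, 0 ≤ t → t ≤ 1 → g ((1 - t) • x + t • y) ≤
      (1 - t) * g x + t * g y - κ / 2 * t * (1 - t) * ‖x - y‖ ^ 2)
    (hsc : Convex ℝ s) {z v x : E} (hz : z ∈ s) (hx : x ∈ s)
    (hup : ∀ y ∈ s, g y ≤ g z + ⟪v, y - z⟫_ℝ + K * ‖y - z‖ ^ 2) :
    g z + ⟪v, x - z⟫_ℝ + κ / 2 * ‖x - z‖ ^ 2 ≤ g x := by
  set d := x - z with hd
  have hev : ∀ᶠ t : ℝ in 𝓝[>] 0,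
      g z + ⟪v, d⟫_ℝ + κ / 2 * (1 - t) * ‖d‖ ^ 2 - (K - κ) * t * ‖d‖ ^ 2 ≤ g x := by
    -- The upper model at the reflected point `z - t • d` and midpoint convexity bound `g (z + t •
    -- d)` from below.
    have hcurve : Tendsto (fun t : ℝ => z + (-t) • d) (𝓝[>] 0) (𝓝 z) := by
      have : Continuous fun t : ℝ => z + (-t) • d := by fun_prop
      simpa using (this.tendsto 0).mono_left (nhdsWithin_le_nhds (s := Set.Ioi 0))
    have hlt1 : ∀ᶠ t : ℝ in 𝓝[>] 0, t < 1 := nhdsWithin_le_nhds (gt_mem_nhds one_pos)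
    filter_upwards [hcurve.eventually (hs.mem_nhds hz), hlt1, self_mem_nhdsWithin]
      with t hts ht1 ht0
    have ht0 : (0 : ℝ) < t := ht0
    have hpt : (1 - t) • z + t • x = z + t • d := by rw [hd]; module
    have hts' : z + t • d ∈ s := hpt ▸ hsc hz hx (sub_nonneg.2 ht1.le) ht0.le (by ring)
    have h1 := hg z hz x hx t ht0.le ht1.le
    have h2 := hg _ hts _ hts' (1 / 2) (by norm_num) (by norm_num)
    have h3 := hup _ hts
    have hmid : (1 - 1 / 2 : ℝ) • (z + (-t) • d) + (1 / 2 : ℝ) • (z + t • d) = z := by module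
    have hdif : z + (-t) • d - (z + t • d) = (-2 * t) • d := by module
    rw [hpt, norm_sub_rev, ← hd] at h1
    rw [hmid, hdif, norm_smul, mul_pow, Real.norm_eq_abs, sq_abs] at h2
    rw [add_sub_cancel_left, inner_smul_right, norm_smul, mul_pow, Real.norm_eq_abs, sq_abs] at h3
    have h4 : t * (g z + ⟪v, d⟫_ℝ + κ / 2 * (1 - t) * ‖d‖ ^ 2 - (K - κ) * t * ‖d‖ ^ 2)
        ≤ t * g x := by linarith
    exact le_of_mul_le_mul_left h4 ht0
  have hc : Continuous fun t : ℝ =>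
      g z + ⟪v, d⟫_ℝ + κ / 2 * (1 - t) * ‖d‖ ^ 2 - (K - κ) * t * ‖d‖ ^ 2 := by fun_prop
  have hlim := (hc.tendsto 0).mono_left (nhdsWithin_le_nhds (s := Set.Ioi 0))
  simpa using le_of_tendsto hlim hev

/-- A strong subgradient inequality for the Moreau envelope transfers to the function. -/
lemma le_of_le_moreauEnvelope {φ : E → EReal} (hbot : ∀ x, φ x ≠ ⊥) {lam σ : ℝ} (hlam : 0 < lam)
    (hσ : 0 < σ) {u v x : E} {a : ℝ}
    (h : ((a + lam / 2 * ‖v‖ ^ 2 + ⟪v, (1 + σ * lam) • (x - u)⟫_ℝ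
        + σ / (1 + σ * lam) / 2 * ‖(1 + σ * lam) • (x - u)‖ ^ 2 : ℝ) : EReal) ≤
      moreauEnvelope lam φ (u + lam • v + (1 + σ * lam) • (x - u))) :
    ((a + ⟪v, x - u⟫_ℝ + σ / 2 * ‖x - u‖ ^ 2 : ℝ) : EReal) ≤ φ x := by
  induction hφ : φ x with
  | bot => exact absurd hφ (hbot _)
  | top => simp
  | coe b =>
    -- The factor `1 + σ * lam` is the displacement at which the parallel-sum bound is an equality,
    -- so modulus `σ` is recovered exactly.
    have h1 := h.trans (moreauEnvelope_le lam hφ _)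
    norm_cast at h1 ⊢
    have hpos : 0 < 1 + σ * lam := by positivity
    have hv : x - (u + lam • v + (1 + σ * lam) • (x - u)) =
        -(lam • (v + σ • (x - u))) := by module
    have hsq : ∀ (k : ℝ) (y : E), ‖k • y‖ ^ 2 = k ^ 2 * ‖y‖ ^ 2 := fun k y => by
      rw [norm_smul, mul_pow, Real.norm_eq_abs, sq_abs]
    rw [hv, norm_neg, hsq, hsq, norm_add_sq_real v, hsq, inner_smul_right, inner_smul_right] at h1
    have e1 : σ / (1 + σ * lam) / 2 * ((1 + σ * lam) ^ 2 * ‖x - u‖ ^ 2) =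
        σ / 2 * (1 + σ * lam) * ‖x - u‖ ^ 2 := by field_simp
    have e2 : 1 / (2 * lam) * (lam ^ 2 * (‖v‖ ^ 2 + 2 * (σ * ⟪v, x - u⟫_ℝ)
        + σ ^ 2 * ‖x - u‖ ^ 2)) = lam / 2 * (‖v‖ ^ 2 + 2 * (σ * ⟪v, x - u⟫_ℝ)
        + σ ^ 2 * ‖x - u‖ ^ 2) := by field_simp
    rw [e1, e2] at h1
    linarith

/-! ### The strongly convex model -/

/-- The supremum of the quadratics of curvature `σ` with parameters (base point, slope, value)
in `G`. -/
noncomputable def supQuadratic (σ : ℝ) (G : Set (E × E × ℝ)) (x : E) : EReal :=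
  ⨆ g ∈ G, ((g.2.2 + ⟪g.2.1, x - g.1⟫_ℝ + σ / 2 * ‖x - g.1‖ ^ 2 : ℝ) : EReal)

lemma le_supQuadratic (σ : ℝ) {G : Set (E × E × ℝ)} {u v : E} {a : ℝ} (h : (u, v, a) ∈ G) (x : E) :
    ((a + ⟪v, x - u⟫_ℝ + σ / 2 * ‖x - u‖ ^ 2 : ℝ) : EReal) ≤ supQuadratic σ G x :=
  le_iSup₂ (f := fun (g : E × E × ℝ) (_ : g ∈ G) =>
    ((g.2.2 + ⟪g.2.1, x - g.1⟫_ℝ + σ / 2 * ‖x - g.1‖ ^ 2 : ℝ) : EReal)) (u, v, a) h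

lemma lowerSemicontinuous_supQuadratic (σ : ℝ) (G : Set (E × E × ℝ)) :
    LowerSemicontinuous (supQuadratic σ G) := by
  refine lowerSemicontinuous_biSup fun g _ => Continuous.lowerSemicontinuous ?_
  exact continuous_coe_real_ereal.comp (by fun_prop)

/-- Each quadratic satisfies the inequality with equality, and its values on the right are bounded
by the supremum. -/
lemma isStronglyConvexOn_supQuadratic (σ : ℝ) (G : Set (E × E × ℝ)) {s : Set E}
    (hs : Convex ℝ s) : IsStronglyConvexOn s σ (supQuadratic σ G) := by
  refine ⟨hs, fun x _ y _ t ht0 ht1 => iSup₂_le ?_⟩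
  rintro ⟨u, v, a⟩ hg
  have ht1' : (0 : EReal) ≤ ((1 - t : ℝ) : EReal) := by exact_mod_cast sub_nonneg.2 ht1
  have ht0' : (0 : EReal) ≤ (t : EReal) := by exact_mod_cast ht0
  have h := EReal.sub_le_sub (add_le_add
    (mul_le_mul_of_nonneg_left (le_supQuadratic σ hg x) ht1')
    (mul_le_mul_of_nonneg_left (le_supQuadratic σ hg y) ht0'))
    (le_refl ((σ / 2 * t * (1 - t) * ‖x - y‖ ^ 2 : ℝ) : EReal))
  refine le_trans (le_of_eq ?_) h
  norm_cast
  have hpt : (1 - t) • x + t • y - u = (1 - t) • (x - u) + t • (y - u) := by module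
  rw [hpt, norm_convexCombo_sq, inner_add_right, inner_smul_right, inner_smul_right,
    sub_sub_sub_cancel_right]
  ring

/-! ### Localization and the converse -/

/-- Replacing a proximal point by another point of its prox-regular localization: if the local
subgradient inequality at `u` is tested at a global proximal point `p` of `u + lam • v`, then `u`
is a proximal point too. -/
lemma HasProxMinorant.of_le {φ : E → EReal} {lam r : ℝ} (hlam : 0 < lam) (hr : lam * r ≤ 1)
    {u v p q : E} {a b : ℝ} (hu : φ u = a) (h : HasProxMinorant φ lam⁻¹ p q b)
    (hz : p + lam • q = u + lam • v)
    (hle : a + ⟪v, p - u⟫_ℝ - r / 2 * ‖p - u‖ ^ 2 ≤ b) : HasProxMinorant φ lam⁻¹ u v a := by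
  refine ⟨hu, fun y => le_trans ?_ (h.le y)⟩
  norm_cast
  -- With this slope the two minorants differ by a constant in `y`, at least `(lam⁻¹ - r) / 2 * ‖p -
  -- u‖ ^ 2`.
  have hq : q = v - lam⁻¹ • (p - u) := by
    have : lam • q = lam • v - (p - u) := by
      rw [eq_sub_iff_add_eq, ← add_left_inj u, ← add_comm u (lam • v), ← hz]
      abel
    rw [← inv_smul_smul₀ hlam.ne' q, this, smul_sub, inv_smul_smul₀ hlam.ne']
  have hyu : y - u = (y - p) + (p - u) := by abel
  rw [hq, hyu, norm_add_sq_real, inner_sub_left v, inner_smul_left, inner_add_right, conj_trivial,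
    real_inner_comm (y - p) (p - u)]
  have hrl : r ≤ lam⁻¹ := by
    rw [← one_div, le_div_iff₀ hlam]
    linarith
  have := mul_le_mul_of_nonneg_right hrl (sq_nonneg ‖p - u‖)
  linarith

/-- Prox-regularity and local strong convexity of one Moreau envelope, with a sufficiently small
parameter, give a uniform strong subgradient inequality on a localization of the graph. -/
lemma exists_localized_strong_subgradient {φ : E → EReal} (hbot : ∀ x, φ x ≠ ⊥) {xb vb : E}
    {a ε r lam σ η : ℝ} (hσ : 0 < σ) (hε : 0 < ε) (hlam : 0 < lam)
    (hr : lam * r ≤ 1) (hη : 0 < η)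
    (hpr : ∀ x ∈ Metric.closedBall xb ε, ∀ u ∈ Metric.closedBall xb ε,
      ∀ v ∈ Metric.closedBall vb ε, (u, v) ∈ subdifferentialGraph φ → φ u < φ xb + (ε : EReal) →
        φ u + ((⟪v, x - u⟫_ℝ - r / 2 * ‖x - u‖ ^ 2 : ℝ) : EReal) ≤ φ x)
    (hprox : ∀ z ∈ Metric.ball (xb + lam • vb) η, ∃ p ∈ Metric.ball xb ε, ∃ q ∈ Metric.ball vb ε,
      ∃ b < a + ε, p + lam • q = z ∧ HasProxMinorant φ lam⁻¹ p q b)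
    (henv : IsLocallyStronglyConvexAt (moreauEnvelope lam φ) (xb + lam • vb)
      (σ / (1 + σ * lam))) :
    ∃ δ > 0, δ ≤ ε ∧ ∀ u ∈ Metric.ball xb δ, ∀ v ∈ Metric.ball vb δ, ∀ b : ℝ, φ u = b →
      φ u < φ xb + (ε : EReal) → v ∈ limitingSubdifferential φ u → ∀ x ∈ Metric.ball xb δ,
        ((b + ⟪v, x - u⟫_ℝ + σ / 2 * ‖x - u‖ ^ 2 : ℝ) : EReal) ≤ φ x := by
  obtain ⟨W, hW, -, hWc⟩ := henv
  obtain ⟨ρ₀, hρ₀, hρW⟩ := Metric.mem_nhds_iff.1 hW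
  set ρ := min ρ₀ η
  have hρ : 0 < ρ := lt_min hρ₀ hη
  set zb := xb + lam • vb
  set B := Metric.ball zb ρ
  have hBW : B ⊆ W := (Metric.ball_subset_ball (min_le_left _ _)).trans hρW
  have hBη : B ⊆ Metric.ball zb η := Metric.ball_subset_ball (min_le_right _ _)
  set g : E → ℝ := fun z => (moreauEnvelope lam φ z).toReal with hg
  have hgB : ∀ z ∈ B, moreauEnvelope lam φ z = g z := by
    intro z hz
    obtain ⟨p, -, q, -, b, -, hpq, hmin⟩ := hprox z (hBη hz)
    rw [hg]
    simp only
    rw [← hpq, hmin.moreauEnvelope_eq hlam, EReal.toReal_coe]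
  have hBc : Convex ℝ B := convex_ball _ _
  have hgc : ∀ x ∈ B, ∀ y ∈ B, ∀ t : ℝ, 0 ≤ t → t ≤ 1 → g ((1 - t) • x + t • y) ≤
      (1 - t) * g x + t * g y - σ / (1 + σ * lam) / 2 * t * (1 - t) * ‖x - y‖ ^ 2 := by
    intro x hx y hy t ht0 ht1
    have := hWc x (hBW hx) y (hBW hy) t ht0 ht1
    rw [hgB x hx, hgB y hy, hgB _ (hBc hx hy (sub_nonneg.2 ht1) ht0 (by ring))] at this
    exact_mod_cast this
  -- `1 + lam` controls `u + lam • v`; the rest controls the extra shift `(1 + σ * lam) • (x - u)`,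
  -- where `‖x - u‖ ≤ 2 * δ`.
  set L := 1 + lam + 2 * (1 + σ * lam) with hL
  have hLpos : 0 < L := by positivity
  refine ⟨min ε (ρ / L), by positivity, min_le_left _ _, fun u hu v hv b hb hφu huv x hx => ?_⟩
  set δ := min ε (ρ / L)
  have hδ : 0 < δ := lt_min hε (div_pos hρ hLpos)
  have hδρ : L * δ ≤ ρ := by
    have : δ ≤ ρ / L := min_le_right _ _
    rw [le_div_iff₀ hLpos] at this
    linarith
  have hδε : ∀ c : E, Metric.ball c δ ⊆ Metric.closedBall c ε := fun c =>
    (Metric.ball_subset_ball (min_le_left _ _)).trans Metric.ball_subset_closedBall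
  have hun : ‖u - xb‖ < δ := mem_ball_iff_norm.1 hu
  have hvn : ‖v - vb‖ < δ := mem_ball_iff_norm.1 hv
  have hxn : ‖x - xb‖ < δ := mem_ball_iff_norm.1 hx
  have hxu : ‖x - u‖ ≤ 2 * δ := by
    have := norm_sub_le (x - xb) (u - xb)
    rw [sub_sub_sub_cancel_right] at this
    linarith
  have hzn : ‖u + lam • v - zb‖ < (1 + lam) * δ := by
    have : u + lam • v - zb = (u - xb) + lam • (v - vb) := by simp only [zb]; module
    rw [this]
    refine (norm_add_le _ _).trans_lt ?_
    rw [norm_smul, Real.norm_eq_abs, abs_of_pos hlam]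
    nlinarith
  have hσl : 0 < σ * lam := mul_pos hσ hlam
  have hzB : u + lam • v ∈ B := by
    rw [mem_ball_iff_norm]
    nlinarith
  have hz'B : u + lam • v + (1 + σ * lam) • (x - u) ∈ B := by
    rw [mem_ball_iff_norm, add_sub_right_comm]
    refine (norm_add_le _ _).trans_lt ?_
    rw [norm_smul, Real.norm_eq_abs, abs_of_pos (by positivity : 0 < 1 + σ * lam)]
    have := mul_le_mul_of_nonneg_left hxu (by positivity : 0 ≤ 1 + σ * lam)
    nlinarith
  obtain ⟨p, hp, q, -, e, -, hpq, hmin⟩ := hprox _ (hBη hzB)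
  have hle := hpr p (Metric.ball_subset_closedBall hp) u (hδε _ hu) v (hδε _ hv) huv hφu
  rw [hb, hmin.eq] at hle
  norm_cast at hle
  have humin : HasProxMinorant φ lam⁻¹ u v b := hmin.of_le hlam hr hb hpq (by linarith)
  have hgu : g (u + lam • v) = b + lam / 2 * ‖v‖ ^ 2 := by
    rw [hg]
    simp only
    rw [humin.moreauEnvelope_eq hlam, EReal.toReal_coe]
  refine le_of_le_moreauEnvelope hbot hlam hσ ?_
  rw [hgB _ hz'B]
  -- The upper model comes from the competitor `u` in the envelope, which is optimal at `u + lam •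
  -- v`.
  have := strong_subgradient_of_quadratic_upper_bound (K := 1 / (2 * lam)) (v := v)
    Metric.isOpen_ball hgc hBc hzB hz'B (fun y hy => ?_)
  · rw [hgu, add_sub_cancel_left] at this
    exact_mod_cast this
  · have hy1 := moreauEnvelope_le lam hb y
    rw [hgB y hy] at hy1
    norm_cast at hy1
    refine hy1.trans (le_of_eq ?_)
    have huy : u - y = -((y - (u + lam • v)) + lam • v) := by module
    rw [hgu, huy, norm_neg, norm_add_sq_real, inner_smul_right, norm_smul, mul_pow,
      Real.norm_eq_abs, sq_abs, real_inner_comm]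
    field_simp
    ring

/-- Prox-regularity together with local strong convexity of the Moreau envelopes implies
variational strong convexity. -/
lemma IsProxRegularAt.isVariationallyStronglyConvexAt [ProperSpace E] {φ : E → EReal}
    (hbot : ∀ x, φ x ≠ ⊥) (hlsc : LowerSemicontinuous φ) (hpb : IsProxBounded φ) {xb vb : E}
    (hvb : vb ∈ limitingSubdifferential φ xb) {σ : ℝ} (hσ : 0 < σ) (h : IsProxRegularAt φ xb vb)
    {lam₀ : ℝ} (hlam₀ : 0 < lam₀) (henv : ∀ lam : ℝ, 0 < lam → lam < lam₀ →
      IsLocallyStronglyConvexAt (moreauEnvelope lam φ) (xb + lam • vb) (σ / (1 + σ * lam))) :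
    IsVariationallyStronglyConvexAt φ xb vb σ := by
  obtain ⟨ε, hε, r, hr, hpr⟩ := h
  obtain ⟨a, ha⟩ := exists_real_of_mem_effDomain hbot hvb.1
  have haε : φ xb < φ xb + (ε : EReal) := by
    rw [ha]; exact_mod_cast lt_add_of_pos_right a hε
  obtain ⟨R, hrR, hR⟩ := hpb.exists_hasProxMinorant (v := vb) hbot ha hr hε (fun y hy => by
    refine le_trans (le_of_eq ?_) (hpr y hy xb (Metric.mem_closedBall_self hε.le) vb
      (Metric.mem_closedBall_self hε.le) hvb haε)
    rw [ha]
    norm_cast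
    ring)
  set lam := min (lam₀ / 2) (1 / (2 * (R + 1)))
  have hR0 : 0 ≤ R := hr.trans hrR
  have hlam : 0 < lam := by positivity
  have hlamR : lam * R ≤ 1 / 2 := by
    have : lam ≤ 1 / (2 * (R + 1)) := min_le_right _ _
    rw [le_div_iff₀ (by positivity)] at this
    linarith
  have hlamr : lam * r ≤ 1 := by nlinarith
  have hlam' : lam < lam₀ := (min_le_left _ _).trans_lt (half_lt_self hlam₀)
  obtain ⟨η, hη, hprox⟩ := hR.eventually_exists_proximal hbot hlsc hlam hlamR hε
  obtain ⟨δ', hδ', hδε, hstrong⟩ := exists_localized_strong_subgradient hbot hσ hε hlam hlamr hη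
    hpr hprox (henv lam hlam hlam')
  -- The smaller radius `δ'` forces these proximal triples into the set `G` defining `ψ`.
  obtain ⟨η', hη', hprox'⟩ := hR.eventually_exists_proximal hbot hlsc hlam hlamR hδ'
  set G : Set (E × E × ℝ) := {g | g.1 ∈ Metric.ball xb δ' ∧ g.2.1 ∈ Metric.ball vb δ' ∧
    φ g.1 = g.2.2 ∧ φ g.1 < φ xb + (ε : EReal) ∧ g.2.1 ∈ limitingSubdifferential φ g.1} with hG
  set ψ := supQuadratic σ G
  have hψle : ∀ x ∈ Metric.ball xb δ', ψ x ≤ φ x := by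
    refine fun x hx => iSup₂_le ?_
    rintro ⟨u, v, b⟩ ⟨hu, hv, hb, hφu, huv⟩
    exact hstrong u hu v hv b hb hφu huv x hx
  have hbG : (xb, vb, a) ∈ G :=
    ⟨Metric.mem_ball_self hδ', Metric.mem_ball_self hδ', ha, haε, hvb⟩
  have hψG : ∀ {u v : E} {b : ℝ}, (u, v, b) ∈ G → ψ u = b := by
    intro u v b hu
    refine le_antisymm ((hψle u hu.1).trans hu.2.2.1.le) ?_
    simpa using le_supQuadratic σ hu u
  have hψbot : ∀ x, ψ x ≠ ⊥ := fun x hx => by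
    have := le_supQuadratic σ hbG x
    rw [show supQuadratic σ G x = ⊥ from hx, le_bot_iff] at this
    exact EReal.coe_ne_bot _ this
  have hGψ : ∀ {u v : E} {b : ℝ}, (u, v, b) ∈ G → v ∈ limitingSubdifferential ψ u := by
    intro u v b hu
    refine regularSubdifferential_subset_limiting ψ u
      (mem_regularSubdifferential_of_eventually (c := -σ) (hψG hu) (Eventually.of_forall fun y => ?_))
    refine le_trans (le_of_eq ?_) (le_supQuadratic σ hu y)
    congr 1
    ring
  set δ := min δ' (η' / (1 + lam))
  have hδ : 0 < δ := by positivity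
  have hsub : ∀ c : E, Metric.ball c δ ⊆ Metric.ball c δ' := fun c =>
    Metric.ball_subset_ball (min_le_left _ _)
  have hgph : ({x | x ∈ Metric.ball xb δ ∧ φ x < φ xb + (ε : EReal)} ×ˢ Metric.ball vb δ) ∩
      subdifferentialGraph φ = (Metric.ball xb δ ×ˢ Metric.ball vb δ) ∩
      subdifferentialGraph ψ := by
    ext ⟨x, v⟩
    constructor
    · rintro ⟨⟨⟨hx, hφx⟩, hv⟩, hxv⟩
      obtain ⟨b, hb⟩ := exists_real_of_mem_effDomain hbot (show x ∈ effDomain φ from hxv.1)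
      exact ⟨⟨hx, hv⟩, hGψ (b := b) ⟨hsub _ hx, hsub _ hv, hb, hφx, hxv⟩⟩
    · rintro ⟨⟨hx, hv⟩, hxv⟩
      have hx : x ∈ Metric.ball xb δ := hx
      have hv : v ∈ Metric.ball vb δ := hv
      have hxv : v ∈ limitingSubdifferential ψ x := hxv
      have hz : x + lam • v ∈ Metric.ball (xb + lam • vb) η' := by
        rw [mem_ball_iff_norm] at hx hv ⊢
        have : x + lam • v - (xb + lam • vb) = (x - xb) + lam • (v - vb) := by module
        rw [this]
        refine (norm_add_le _ _).trans_lt ?_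
        rw [norm_smul, Real.norm_eq_abs, abs_of_pos hlam]
        have h1 : δ ≤ η' / (1 + lam) := min_le_right _ _
        rw [le_div_iff₀ (by positivity)] at h1
        nlinarith
      obtain ⟨p, hp, q, hq, b, hb, hpq, hmin⟩ := hprox' _ hz
      have hφp : φ p < φ xb + (ε : EReal) := by
        rw [hmin.eq, ha]
        exact_mod_cast hb.trans_le (by linarith)
      have hpG : (p, q, b) ∈ G := ⟨hp, hq, hmin.eq, hφp, hmin.mem_limitingSubdifferential⟩
      obtain ⟨c, hc⟩ := exists_real_of_mem_effDomain hψbot hxv.1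
      -- The whole space is used because `p` need only lie in the `δ'`-ball. Adding the inequalities
      -- at `x` and `p` gives strong monotonicity, while `p - x = lam • (v - q)` has the opposite
      -- sign.
      have h1 := (isStronglyConvexOn_supQuadratic σ G
        convex_univ).add_le_of_mem_limitingSubdifferential isOpen_univ hψbot (Set.mem_univ x) hxv hc
        (Set.mem_univ p)
      have h2 := le_supQuadratic σ hpG x
      rw [show supQuadratic σ G p = b from hψG hpG] at h1
      rw [show supQuadratic σ G x = c from hc] at h2
      norm_cast at h1 h2
      have hpx : p - x = lam • (v - q) := by
        rw [smul_sub, sub_eq_sub_iff_add_eq_add, hpq]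
        abel
      have h3 : ⟪v - q, p - x⟫_ℝ + σ * ‖p - x‖ ^ 2 ≤ 0 := by
        have h4 : ⟪q, x - p⟫_ℝ = -⟪q, p - x⟫_ℝ := by rw [← inner_neg_right, neg_sub]
        rw [h4, norm_sub_rev x p] at h2
        rw [inner_sub_left]
        linarith
      rw [hpx, inner_smul_right, real_inner_self_eq_norm_sq] at h3
      have h5 : ‖v - q‖ ^ 2 = 0 := by
        have : 0 ≤ σ * ‖lam • (v - q)‖ ^ 2 := by positivity
        nlinarith [sq_nonneg ‖v - q‖]
      have hvq : v = q := by simpa [sub_eq_zero] using h5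
      have hpx' : p = x := by simpa [hvq, sub_eq_zero] using hpx
      subst hvq hpx'
      exact ⟨⟨⟨hx, hφp⟩, hv⟩, hmin.mem_limitingSubdifferential⟩
  refine ⟨Metric.ball xb δ, Metric.ball vb δ, Metric.isOpen_ball, convex_ball _ _,
    Metric.mem_ball_self hδ, Metric.isOpen_ball, convex_ball _ _, Metric.mem_ball_self hδ, ψ,
    ⟨hψbot, xb, ?_⟩, (lowerSemicontinuous_supQuadratic σ G).lowerSemicontinuousOn _,
    isStronglyConvexOn_supQuadratic σ G (convex_ball _ _), fun x hx => hψle x (hsub _ hx), ε, hε,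
    hgph, ?_⟩
  · rw [effDomain, Set.mem_ofPred_eq, hψG hbG]
    exact EReal.coe_lt_top a
  · rw [← hgph]
    rintro ⟨x, v⟩ ⟨⟨⟨hx, hφx⟩, hv⟩, hxv⟩
    obtain ⟨b, hb⟩ := exists_real_of_mem_effDomain hbot (show x ∈ effDomain φ from hxv.1)
    exact hb.trans (hψG (v := v) (b := b) ⟨hsub _ hx, hsub _ hv, hb, hφx, hxv⟩).symm

end VariationalAnalysis

theorem theorem4p4 {n : ℕ} (φ : EuclideanSpace ℝ (Fin n) → EReal)
    (hproper : VariationalAnalysis.IsProper φ)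
    (hlsc : LowerSemicontinuous φ)
    (hpb : VariationalAnalysis.IsProxBounded φ)
    (xb vb : EuclideanSpace ℝ (Fin n))
    (hxb : xb ∈ VariationalAnalysis.effDomain φ)
    (hvb : vb ∈ VariationalAnalysis.limitingSubdifferential φ xb)
    (σ : ℝ) (hσ : 0 < σ) :
    VariationalAnalysis.IsVariationallyStronglyConvexAt φ xb vb σ ↔
      (VariationalAnalysis.IsProxRegularAt φ xb vb ∧
        ∃ lam₀ > (0 : ℝ), ∀ lam : ℝ, 0 < lam → lam < lam₀ →
          VariationalAnalysis.IsLocallyStronglyConvexAt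
            (VariationalAnalysis.moreauEnvelope lam φ)
            (xb + lam • vb) (σ / (1 + σ * lam))) := by
  constructor
  · intro h
    exact ⟨h.isProxRegularAt hproper.1 hσ,
      h.isLocallyStronglyConvexAt_moreauEnvelope hproper.1 hlsc hpb hvb hσ⟩
  · rintro ⟨hreg, lam₀, hlam₀, henv⟩
    exact hreg.isVariationallyStronglyConvexAt hproper.1 hlsc hpb hvb hσ hlam₀ henv
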